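/- Let $S$ be a finite alphabet, let $A$ be a transition relation on $S$, and let $\Sigma=\{\omega\in S^{\mathbb N_0}:\ (\omega_i,\omega_{i+1})\in A\ \forall i\ge 0\}$ be the associated one-sided compact topological Markov shift, with the metric $d(\omega,\omega')=2^{-\min\{i:\ \omega_i\neq\omega'_i\}}$ for $\omega\ne\omega'$ and the left shift $T:\Sigma\to\Sigma$. Let $X$ be a non-empty compact metric space, and let $(F_\omega)_{\omega\in\Sigma}$ be a family of homeomorphisms of $X$ such that * for some $\alpha>0$ every $F_\omega$ is $\alpha$-Hölder, and * $\omega\mapsto F_\omega$ is Hölder continuous for the uniform distance: there are $C,\beta>0$ with $d(F_\omega(t),F_{\omega'}(t))\le C\,d(\omega,\omega')^{\beta}$ for all $\omega,\omega'\in\Sigma$, $t\in X$. Let $\{\phi_t\}_{t\in X}$ be an equi-Hölder family of potentials $\phi_t:\Sigma\to\mathbb R$, that is, for some exponent $\beta'>0$ the $\beta'$-Hölder norms of the $\phi_t$ are bounded uniformly in $t$, and suppose that $t\mapsto\phi_t(\omega)$ is continuous for every $\omega\in\Sigma$. Put $F^k_\omega:=F_{T^{k-1}\omega}\circ\cdots\circ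 F_\omega$, $\widehat F(\omega,t):=(T\omega,F_\omega(t))$ and $\widehat\phi(\omega,t):=\phi_t(\omega)$. Fix a letter $a$ and a point $\omega_a\in\Sigma$ whose first letter is $a$. For an admissible word $\underline w=w_0\dots w_{n-1}$ with $w_{n-1}=a$ let $\underline w\omega_a\in\Sigma$ be the sequence obtained by gluing $\underline w$ and $\omega_a$ along the common letter $a$, so that $T^{n-1}(\underline w\omega_a)=\omega_a$. The pressure out of equilibrium is $$\check P(\{\phi_t\}_{t\in X}):=\limsup_{n\to\infty}\frac1n\log\sup_{t\in X}\check Z_n(\phi_t,a),\qquad \check Z_n(\phi_t,a):=\sum_{|\underline w|=n,\ w_{n-1}=a}\exp\Big(\sum_{k=0}^{n-1}\phi_{F^k_{\underline w\omega_a}(t)}\big(T^k(\underline w\omega_a)\big)\Big)$$ (with $\log 0=-\infty$), and the maximal asymptotic instability potential is $$\widetilde\phi(\omega):=\limsup_{n\to\infty}\ \sup_{t\in X}\ \frac1n\sum_{k=0}^{n-1}\widehat\phi\big(\widehat F^k(\omega,t)\big).$$ Then $\widetilde\phi$ is integrable with respect to every ergodic $T$-invariant Borel probability measure on $\Sigma$,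 and for every choice of $a$ and $\omega_a$ $$\check P(\{\phi_t\}_{t\in X})\ \le\ \sup_{\nu}\Big\{h_\nu(T)+\int_\Sigma\widetilde\phi\,d\nu\Big\},$$ where the supremum is over all ergodic $T$-invariant Borel probability measures $\nu$ on $\Sigma$ and $h_\nu(T)$ is the Kolmogorov–Sinai entropy. -/

import Mathlib

open MeasureTheory Filter
open scoped NNReal ENNReal

noncomputable section

namespace POE

/-- The one-sided topological Markov shift with alphabet `S` and transition relation `A`:
all sequences `ω₀ ω₁ ω₂ …` of letters with `A ωᵢ ωᵢ₊₁` for every `i`. -/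
@[ext]
structure MarkovShift {S : Type*} (A : S → S → Prop) where
  /-- the sequence of letters -/
  seq : ℕ → S
  /-- every transition is admissible -/
  adm : ∀ i, A (seq i) (seq (i + 1))

namespace MarkovShift

variable {S : Type*} {A : S → S → Prop}

theorem seq_injective : Function.Injective (seq : MarkovShift A → ℕ → S) :=
  fun _ _ h => MarkovShift.ext h

/-- The standard metric: `dist ω ω' = 2⁻ⁿ`, with `n` the first index at which `ω` and `ω'` differ.
It induces the topology of pointwise convergence (with discrete `S`). -/
instance : MetricSpace (MarkovShift A) :=
  letI : TopologicalSpace S := ⊥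
  haveI : DiscreteTopology S := ⟨rfl⟩
  MetricSpace.induced seq seq_injective PiNat.metricSpace

instance : MeasurableSpace (MarkovShift A) := borel _

instance : BorelSpace (MarkovShift A) := ⟨rfl⟩

/-- The left shift `T`. -/
def shift (ω : MarkovShift A) : MarkovShift A where
  seq i := ω.seq (i + 1)
  adm i := ω.adm (i + 1)

/-- The admissible words `w = w₀ … wₙ₋₁` of length `n` whose last letter `wₙ₋₁` is `a`. -/
def WordTo (A : S → S → Prop) (n : ℕ) (a : S) : Type _ :=
  {w : Fin n → S //
    (∀ i j : Fin n, (j : ℕ) = i + 1 → A (w i) (w j)) ∧ ∀ i : Fin n, (i : ℕ) + 1 = n → w i = a}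

instance [Finite S] (n : ℕ) (a : S) : Finite (WordTo A n a) :=
  inferInstanceAs (Finite (Subtype _))

instance [Finite S] (n : ℕ) (a : S) : Fintype (WordTo A n a) := Fintype.ofFinite _

/-- The point `w ω` obtained by gluing a word `w` of length `n` that ends in the letter `a` to a
point `ω = (a, ω₁, ω₂, …)` of the cylinder `[a]` along the common letter `a`:
the sequence `w₀, …, wₙ₋₂, a, ω₁, ω₂, …`. -/
def glue {n : ℕ} (ω : MarkovShift A) (w : WordTo A n (ω.seq 0)) : MarkovShift A where
  seq i := if h : i < n then w.1 ⟨i, h⟩ else ω.seq (i + 1 - n)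
  adm i := by
    by_cases h : i + 1 < n
    · have h' : i < n := by omega
      simp only [h, h', dif_pos]
      exact w.2.1 _ _ rfl
    · by_cases h' : i < n
      · have hn : i + 1 = n := by omega
        have e : w.1 ⟨i, h'⟩ = ω.seq 0 := w.2.2 ⟨i, h'⟩ hn
        have e2 : i + 1 + 1 - n = 0 + 1 := by omega
        simp only [h, h', dif_pos, dif_neg, not_false_eq_true, e, e2]
        exact ω.adm 0
      · have e2 : i + 1 + 1 - n = i + 1 - n + 1 := by omega
        simp only [h, h', dif_neg, not_false_eq_true, e2]
        exact ω.adm _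

end MarkovShift

section Entropy

variable {Ω : Type*} [MeasurableSpace Ω]

/-- The Shannon entropy `H_ν(q) = -∑ᵢ ν(q⁻¹{i}) log ν(q⁻¹{i})` of the finite partition
`{q⁻¹{i}}` given by a labelling `q : Ω → ι`. -/
def partitionEntropy {ι : Type*} [Fintype ι] (ν : Measure Ω) (q : Ω → ι) : ℝ :=
  ∑ i, Real.negMulLog (ν.real (q ⁻¹' {i}))

/-- The Kolmogorov–Sinai entropy `h_ν(T)`: the supremum over all finite measurable partitions
`p : Ω → Fin k` of `lim (1/n) H_ν(p ∨ T⁻¹p ∨ … ∨ T⁻⁽ⁿ⁻¹⁾p)`. -/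
def ksEntropy (T : Ω → Ω) (ν : Measure Ω) : EReal :=
  ⨆ (k : ℕ) (p : Ω → Fin k) (_ : Measurable p),
    limsup (fun n : ℕ =>
      ((partitionEntropy ν (fun ω (j : Fin n) => p (T^[j] ω)) / n : ℝ) : EReal)) atTop

end Entropy

variable {S : Type*} {A : S → S → Prop} {X : Type*}

/-- `F^k_ω = F_{T^{k-1}ω} ∘ ⋯ ∘ F_ω`. -/
def fiberIter (F : MarkovShift A → X → X) : ℕ → MarkovShift A → X → X
  | 0, _, t => t
  | k + 1, ω, t => F (MarkovShift.shift^[k] ω) (fiberIter F k ω t)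

/-- The skew product `F̂(ω, t) = (Tω, F_ω(t))`. -/
def skewProduct (F : MarkovShift A → X → X) (p : MarkovShift A × X) : MarkovShift A × X :=
  (p.1.shift, F p.1 p.2)

/-- `φ̂(ω, t) = φ_t(ω)`. -/
def jointPotential (φ : X → MarkovShift A → ℝ) (p : MarkovShift A × X) : ℝ :=
  φ p.2 p.1

/-- `Ž_n(φ_t, a) = ∑_{|w| = n, w_{n-1} = a} exp (∑_{k<n} φ_{F^k_{w ω_a}(t)} (T^k (w ω_a)))`,
with `a` the first letter of `ω_a`. -/
def partitionSum [Finite S] (F : MarkovShift A → X → X) (φ : X → MarkovShift A → ℝ)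
    (ωa : MarkovShift A) (n : ℕ) (t : X) : ℝ :=
  ∑ w : MarkovShift.WordTo A n (ωa.seq 0),
    Real.exp (∑ k ∈ Finset.range n,
      φ (fiberIter F k (ωa.glue w) t) (MarkovShift.shift^[k] (ωa.glue w)))

/-- The pressure out of equilibrium `limsup (1/n) log sup_t Ž_n(φ_t, a)`, computed with the
base point `ω_a ∈ [a]`; here `log 0 = -∞`. -/
def pressure [Finite S] (F : MarkovShift A → X → X) (φ : X → MarkovShift A → ℝ)
    (ωa : MarkovShift A) : EReal :=
  limsup (fun n : ℕ =>
    ENNReal.log (⨆ t : X, ENNReal.ofReal (partitionSum F φ ωa n t)) / (n : EReal)) atTop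

/-- The maximal asymptotic instability potential
`φ̃(ω) = limsup_n sup_t (1/n) ∑_{k<n} φ̂(F̂^k(ω, t))`. -/
def maxInstability (F : MarkovShift A → X → X) (φ : X → MarkovShift A → ℝ)
    (ω : MarkovShift A) : ℝ :=
  limsup (fun n : ℕ =>
    ⨆ t : X, (1 / (n : ℝ)) *
      ∑ k ∈ Finset.range n, jointPotential φ ((skewProduct F)^[k] (ω, t))) atTop

end POE

end

/-! The supremum over `t` is taken for each base point separately: Φ_n(ω) = sup_t of the n-th
Birkhoff sum of φ̂ along F̂. Splitting an orbit makes Φ a subadditive cocycle over the shift. It is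
continuous because X is compact, and φ̃ = limsup Φ_n / n. The partition sums are bounded by ∑_w exp
Φ_n(w ω_a), so what remains is one half of a subadditive variational principle on Σ.

Misiurewicz's argument gives that half. The glued points have distinct n-itineraries, so their Gibbs
weights form a measure whose free energy H_n + ∫ Φ_n is exactly the log of the sum
(`exists_freeEnergy_eq_log_sum_exp`). If c is below the pressure, this free energy is at least cn
for infinitely many n. Averaging along orbits and passing to a weak limit yields an invariant ν₀
whose q-th free energy is at least cq for every q (`exists_measurePreserving_forall_le`).

No ergodic decomposition is needed. The limiting free energy G is upper semicontinuous, being an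
infimum of continuous functions, and convex on invariant measures. An extreme point of its set of
maximisers is therefore extreme among invariant measures, hence ergodic
(`exists_ergodic_forall_le`). For that ν, the entropy term divided by q converges to at most h_ν(T),
and reverse Fatou bounds the limit of ∫ Φ_q / q by ∫ φ̃ dν, so Kingman's theorem is not needed
either. -/

namespace POE

open scoped Topology

/-! ### Inequalities for -x log x. -/

section NegMulLog

/-- Pointwise form of the Gibbs inequality. -/
theorem negMulLog_le_neg_mul_log_add {p r : ℝ} (hp : 0 ≤ p) (hr : 0 ≤ r) (h : r = 0 → p = 0) :
    Real.negMulLog p ≤ -p * Real.log r + (r - p) := by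
  rcases hp.eq_or_lt with rfl | hp'
  · simpa using hr
  have hr' : 0 < r := hr.lt_of_ne fun h0 => hp'.ne' (h h0.symm)
  have h1 : Real.log (r / p) ≤ r / p - 1 := Real.log_le_sub_one_of_pos (by positivity)
  rw [Real.log_div hr'.ne' hp'.ne'] at h1
  have h2 := mul_le_mul_of_nonneg_left h1 hp
  have h3 : p * (r / p - 1) = r - p := by field_simp
  rw [h3] at h2
  rw [Real.negMulLog]
  linarith

theorem negMulLog_add_le {u v : ℝ} (hu : 0 ≤ u) (hv : 0 ≤ v) :
    Real.negMulLog (u + v) ≤ Real.negMulLog u + Real.negMulLog v := by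
  rcases hu.eq_or_lt with rfl | hu'
  · simp
  rcases hv.eq_or_lt with rfl | hv'
  · simp
  have h1 : Real.log u ≤ Real.log (u + v) := Real.log_le_log hu' (by linarith)
  have h2 : Real.log v ≤ Real.log (u + v) := Real.log_le_log hv' (by linarith)
  simp only [Real.negMulLog]
  nlinarith

end NegMulLog

/-! ### Shannon entropy of finite partitions. -/

section Entropy

variable {Ω ι κ : Type*} [MeasurableSpace Ω] [Fintype ι] [Fintype κ]

theorem partitionEntropy_comp_equiv (ν : Measure Ω) (q : Ω → ι) (e : ι ≃ κ) :
    partitionEntropy ν (e ∘ q) = partitionEntropy ν q := by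
  rw [partitionEntropy, partitionEntropy, ← e.sum_comp]
  refine Finset.sum_congr rfl fun i _ => ?_
  congr 2
  ext ω
  simp

theorem partitionEntropy_nonneg (ν : Measure Ω) [IsProbabilityMeasure ν] (q : Ω → ι) :
    0 ≤ partitionEntropy ν q :=
  Finset.sum_nonneg fun _ _ => Real.negMulLog_nonneg measureReal_nonneg measureReal_le_one

/-- Concavity of the Shannon entropy as a function of the measure. -/
theorem sum_mul_partitionEntropy_le {J : Type*} (s : Finset J) {c : J → ℝ} (hc : ∀ j ∈ s, 0 ≤ c j)
    (hc1 : ∑ j ∈ s, c j = 1) (ν : Measure Ω) (μ : J → Measure Ω) (q : Ω → ι)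
    (h : ∀ i, ν.real (q ⁻¹' {i}) = ∑ j ∈ s, c j * (μ j).real (q ⁻¹' {i})) :
    ∑ j ∈ s, c j * partitionEntropy (μ j) q ≤ partitionEntropy ν q := by
  simp only [partitionEntropy, Finset.mul_sum]
  rw [Finset.sum_comm]
  refine Finset.sum_le_sum fun i _ => ?_
  rw [h i]
  simpa using Real.concaveOn_negMulLog.le_map_sum hc hc1
    (p := fun j => (μ j).real (q ⁻¹' {i})) fun j _ => measureReal_nonneg

variable [MeasurableSpace ι] [MeasurableSingletonClass ι]
  [MeasurableSpace κ] [MeasurableSingletonClass κ]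

theorem sum_measureReal_preimage_inter (ν : Measure Ω) [IsFiniteMeasure ν] {q : Ω → ι}
    (hq : Measurable q) (s : Set Ω) :
    ∑ i, ν.real (s ∩ q ⁻¹' {i}) = ν.real s := by
  have h := sum_measureReal_preimage_singleton (μ := ν.restrict s) Finset.univ (f := q)
    fun i _ => hq (measurableSet_singleton i)
  simpa [measureReal_restrict_apply (hq (measurableSet_singleton _)), Set.inter_comm] using h

theorem sum_measureReal_preimage (ν : Measure Ω) [IsProbabilityMeasure ν] {q : Ω → ι}
    (hq : Measurable q) : ∑ i, ν.real (q ⁻¹' {i}) = 1 := by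
  simpa using sum_measureReal_preimage_inter ν hq Set.univ

/-- Gibbs inequality against the uniform distribution. -/
theorem partitionEntropy_le_log_card (ν : Measure Ω) [IsProbabilityMeasure ν] {q : Ω → ι}
    (hq : Measurable q) : partitionEntropy ν q ≤ Real.log (Fintype.card ι) := by
  have hne : Nonempty ι := by
    obtain ⟨ω⟩ := nonempty_of_isProbabilityMeasure ν
    exact ⟨q ω⟩
  have hc : (0 : ℝ) < Fintype.card ι := by exact_mod_cast Fintype.card_pos
  calc partitionEntropy ν q
      ≤ ∑ i, (-ν.real (q ⁻¹' {i}) * Real.log ((Fintype.card ι : ℝ)⁻¹)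
          + ((Fintype.card ι : ℝ)⁻¹ - ν.real (q ⁻¹' {i}))) :=
        Finset.sum_le_sum fun i _ => negMulLog_le_neg_mul_log_add measureReal_nonneg
          (by positivity) fun h => absurd h (by positivity)
    _ = Real.log (Fintype.card ι) := by
        rw [Finset.sum_add_distrib, ← Finset.sum_mul, Finset.sum_neg_distrib,
          Finset.sum_sub_distrib, sum_measureReal_preimage ν hq]
        simp [hc.ne']

/-- Gibbs inequality for the joint distribution Q against the product of its marginals P and R. -/
theorem partitionEntropy_prodMk_le (ν : Measure Ω) [IsProbabilityMeasure ν] {q : Ω → ι}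
    {r : Ω → κ} (hq : Measurable q) (hr : Measurable r) :
    partitionEntropy ν (fun ω => (q ω, r ω)) ≤ partitionEntropy ν q + partitionEntropy ν r := by
  set P : ι → ℝ := fun i => ν.real (q ⁻¹' {i}) with hP
  set R : κ → ℝ := fun j => ν.real (r ⁻¹' {j}) with hR
  set Q : ι → κ → ℝ := fun i j => ν.real (q ⁻¹' {i} ∩ r ⁻¹' {j}) with hQ
  have hpre : ∀ i j, (fun ω => (q ω, r ω)) ⁻¹' {(i, j)} = q ⁻¹' {i} ∩ r ⁻¹' {j} := by
    intro i j; ext ω; simp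
  have hQP : ∀ i, ∑ j, Q i j = P i := fun i => sum_measureReal_preimage_inter ν hr _
  have hQR : ∀ j, ∑ i, Q i j = R j := fun j => by
    simpa only [hQ, Set.inter_comm] using sum_measureReal_preimage_inter ν hq (r ⁻¹' {j})
  have hP1 : ∑ i, P i = 1 := sum_measureReal_preimage ν hq
  have hR1 : ∑ j, R j = 1 := sum_measureReal_preimage ν hr
  have hQleP : ∀ i j, Q i j ≤ P i := fun i j => measureReal_mono Set.inter_subset_left
  have hQleR : ∀ i j, Q i j ≤ R j := fun i j => measureReal_mono Set.inter_subset_right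
  have hQ0 : ∀ i j, 0 ≤ Q i j := fun i j => measureReal_nonneg
  have hP0 : ∀ i, 0 ≤ P i := fun i => measureReal_nonneg
  have hR0 : ∀ j, 0 ≤ R j := fun j => measureReal_nonneg
  have key : ∀ i j, Real.negMulLog (Q i j) ≤
      -Q i j * Real.log (P i) + -Q i j * Real.log (R j) + (P i * R j - Q i j) := by
    intro i j
    -- The logarithm of the product splits only for nonzero marginals; if one vanishes, so does the
    -- joint weight below it.
    by_cases h : P i * R j = 0
    · have : Q i j = 0 := by
        rcases mul_eq_zero.1 h with h | h
        · exact le_antisymm (h ▸ hQleP i j) (hQ0 i j)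
        · exact le_antisymm (h ▸ hQleR i j) (hQ0 i j)
      simp [this, h]
    · have h' := mul_ne_zero_iff.1 h
      have := negMulLog_le_neg_mul_log_add (hQ0 i j) (mul_nonneg (hP0 i) (hR0 j))
        fun h0 => absurd h0 h
      rw [Real.log_mul h'.1 h'.2] at this
      linarith
  calc partitionEntropy ν (fun ω => (q ω, r ω)) = ∑ i, ∑ j, Real.negMulLog (Q i j) := by
        rw [partitionEntropy, Fintype.sum_prod_type]
        simp only [hpre, hQ]
    _ ≤ ∑ i, ∑ j, (-Q i j * Real.log (P i) + -Q i j * Real.log (R j) + (P i * R j - Q i j)) :=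
        Finset.sum_le_sum fun i _ => Finset.sum_le_sum fun j _ => key i j
    _ = partitionEntropy ν q + partitionEntropy ν r := by
        simp only [Finset.sum_add_distrib, Finset.sum_sub_distrib]
        have e1 : ∑ i, ∑ j, -Q i j * Real.log (P i) = partitionEntropy ν q := by
          refine Finset.sum_congr rfl fun i _ => ?_
          rw [← Finset.sum_mul, Finset.sum_neg_distrib, hQP, Real.negMulLog]
        have e2 : ∑ i, ∑ j, -Q i j * Real.log (R j) = partitionEntropy ν r := by
          rw [Finset.sum_comm]
          refine Finset.sum_congr rfl fun j _ => ?_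
          rw [← Finset.sum_mul, Finset.sum_neg_distrib, hQR, Real.negMulLog]
        have e3 : ∑ i, ∑ j, P i * R j = 1 := by
          rw [← Finset.sum_mul_sum, hP1, hR1, one_mul]
        have e4 : ∑ i, ∑ j, Q i j = 1 := by simp only [hQP, hP1]
        rw [e1, e2, e3, e4]; ring

theorem partitionEntropy_map {Ω' : Type*} [MeasurableSpace Ω'] (ν : Measure Ω) {f : Ω → Ω'}
    (hf : Measurable f) {q : Ω' → ι} (hq : Measurable q) :
    partitionEntropy (ν.map f) q = partitionEntropy ν (q ∘ f) := by
  refine Finset.sum_congr rfl fun i _ => ?_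
  rw [map_measureReal_apply hf (hq (measurableSet_singleton i))]
  rfl

/-- Convexity of the Shannon entropy up to a bounded error. -/
theorem partitionEntropy_convexComb_le {s t : ℝ} (hs : 0 ≤ s) (ht : 0 ≤ t) (ν μ₁ μ₂ : Measure Ω)
    [IsProbabilityMeasure μ₁] [IsProbabilityMeasure μ₂] {q : Ω → ι} (hq : Measurable q)
    (h : ∀ i, ν.real (q ⁻¹' {i}) = s * μ₁.real (q ⁻¹' {i}) + t * μ₂.real (q ⁻¹' {i})) :
    partitionEntropy ν q ≤ s * partitionEntropy μ₁ q + t * partitionEntropy μ₂ q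
      + (Real.negMulLog s + Real.negMulLog t) := by
  have key : ∀ i, Real.negMulLog (ν.real (q ⁻¹' {i})) ≤
      (s * Real.negMulLog (μ₁.real (q ⁻¹' {i})) + t * Real.negMulLog (μ₂.real (q ⁻¹' {i})))
      + (μ₁.real (q ⁻¹' {i}) * Real.negMulLog s + μ₂.real (q ⁻¹' {i}) * Real.negMulLog t) := by
    intro i
    rw [h i]
    refine (negMulLog_add_le (mul_nonneg hs measureReal_nonneg)
      (mul_nonneg ht measureReal_nonneg)).trans (le_of_eq ?_)
    rw [Real.negMulLog_mul, Real.negMulLog_mul]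
    ring
  refine (Finset.sum_le_sum fun i _ => key i).trans (le_of_eq ?_)
  rw [Finset.sum_add_distrib, Finset.sum_add_distrib, Finset.sum_add_distrib, ← Finset.sum_mul,
    ← Finset.sum_mul, sum_measureReal_preimage μ₁ hq, sum_measureReal_preimage μ₂ hq,
    ← Finset.mul_sum, ← Finset.mul_sum, one_mul, one_mul]
  rfl

end Entropy

/-! ### Subadditive cocycles and their free energy. -/

section FreeEnergy

variable {Ω : Type*} [TopologicalSpace Ω] {k : ℕ}

/-- The labels `p ω, p (T ω), …, p (T^{n-1} ω)` of an orbit segment. -/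
def itinerary (T : Ω → Ω) (p : Ω → Fin k) (n : ℕ) (ω : Ω) : Fin n → Fin k :=
  fun j => p (T^[j] ω)

/-- A continuous subadditive cocycle over `T` of at most linear growth. -/
structure IsSubadditiveCocycle (T : Ω → Ω) (Φ : ℕ → Ω → ℝ) (C : ℝ) : Prop where
  continuous : ∀ n, Continuous (Φ n)
  add_le : ∀ m n ω, Φ (m + n) ω ≤ Φ m ω + Φ n (T^[m] ω)
  bound : ∀ n ω, |Φ n ω| ≤ C * n

theorem continuous_itinerary {T : Ω → Ω} (hT : Continuous T) {p : Ω → Fin k} (hp : Continuous p)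
    (n : ℕ) : Continuous (itinerary T p n) :=
  continuous_pi fun j => hp.comp (hT.iterate j)

variable [MeasurableSpace Ω] [BorelSpace Ω]

/-- `H_μ(p ∨ … ∨ T^{-(n-1)} p) + ∫ Φ_n dμ`. -/
noncomputable def freeEnergy (T : Ω → Ω) (p : Ω → Fin k) (Φ : ℕ → Ω → ℝ) (n : ℕ) (μ : Measure Ω) :
    ℝ :=
  partitionEntropy μ (itinerary T p n) + ∫ ω, Φ n ω ∂μ

/-- An itinerary of length m + n is that of ω of length m followed by that of T^m ω of length n, so
subadditivity for joint partitions applies. -/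
theorem partitionEntropy_itinerary_add_le {T : Ω → Ω} (hT : Continuous T) {p : Ω → Fin k}
    (hp : Continuous p) (μ : Measure Ω) [IsProbabilityMeasure μ] (m n : ℕ) :
    partitionEntropy μ (itinerary T p (m + n)) ≤
      partitionEntropy μ (itinerary T p m) +
        partitionEntropy (μ.map T^[m]) (itinerary T p n) := by
  have hm := (continuous_itinerary hT hp m).measurable
  have hn := (continuous_itinerary hT hp n).measurable
  have hTm := (hT.iterate m).measurable
  rw [partitionEntropy_map μ hTm hn]
  refine le_trans (le_of_eq ?_) (partitionEntropy_prodMk_le μ hm (hn.comp hTm))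
  rw [← partitionEntropy_comp_equiv μ _ (Fin.appendEquiv m n)]
  congr 1
  funext ω j
  refine Fin.addCases (fun i => ?_) (fun i => ?_) j
  · simp [Fin.appendEquiv, itinerary]
  · simp [Fin.appendEquiv, itinerary, ← Function.iterate_add_apply, add_comm]

theorem partitionEntropy_itinerary_le {T : Ω → Ω} (hT : Continuous T) {p : Ω → Fin k}
    (hp : Continuous p) (μ : Measure Ω) [IsProbabilityMeasure μ] (n : ℕ) :
    partitionEntropy μ (itinerary T p n) ≤ Real.log k * n := by
  refine (partitionEntropy_le_log_card μ (continuous_itinerary hT hp n).measurable).trans ?_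
  simp [mul_comm]

namespace IsSubadditiveCocycle

variable {T : Ω → Ω} {Φ : ℕ → Ω → ℝ} {C : ℝ}

theorem integrable (h : IsSubadditiveCocycle T Φ C) (n : ℕ) (μ : Measure Ω) [IsFiniteMeasure μ] :
    Integrable (Φ n) μ :=
  Integrable.of_bound (h.continuous n).measurable.aestronglyMeasurable (C * n)
    (ae_of_all _ fun ω => h.bound n ω)

omit [BorelSpace Ω] in
theorem abs_integral_le (h : IsSubadditiveCocycle T Φ C) (n : ℕ) (μ : Measure Ω)
    [IsProbabilityMeasure μ] : |∫ ω, Φ n ω ∂μ| ≤ C * n := by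
  have := norm_integral_le_of_norm_le_const (μ := μ) (f := Φ n) (C := C * n)
    (ae_of_all _ fun ω => h.bound n ω)
  simpa using this

theorem integral_add_le (h : IsSubadditiveCocycle T Φ C) (hT : Continuous T) (μ : Measure Ω)
    [IsProbabilityMeasure μ] (m n : ℕ) :
    ∫ ω, Φ (m + n) ω ∂μ ≤ ∫ ω, Φ m ω ∂μ + ∫ ω, Φ n ω ∂(μ.map T^[m]) := by
  have hTm := (hT.iterate m).measurable
  have : IsProbabilityMeasure (μ.map T^[m]) := Measure.isProbabilityMeasure_map hTm.aemeasurable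
  have hi : Integrable (fun ω => Φ n (T^[m] ω)) μ :=
    (h.integrable n (μ.map T^[m])).comp_measurable hTm
  rw [integral_map hTm.aemeasurable (h.continuous n).measurable.aestronglyMeasurable,
    ← integral_add (h.integrable m μ) hi]
  exact integral_mono (h.integrable _ μ) ((h.integrable m μ).add hi) fun ω => h.add_le m n ω

variable (h : IsSubadditiveCocycle T Φ C) (hT : Continuous T) {p : Ω → Fin k} (hp : Continuous p)
include h hT hp

theorem freeEnergy_add_le (μ : Measure Ω) [IsProbabilityMeasure μ] (m n : ℕ) :
    freeEnergy T p Φ (m + n) μ ≤ freeEnergy T p Φ m μ + freeEnergy T p Φ n (μ.map T^[m]) := by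
  have h1 := partitionEntropy_itinerary_add_le hT hp μ m n
  have h2 := h.integral_add_le hT μ m n
  simp only [freeEnergy]
  linarith

theorem abs_freeEnergy_le (μ : Measure Ω) [IsProbabilityMeasure μ] (n : ℕ) :
    |freeEnergy T p Φ n μ| ≤ (Real.log k + C) * n := by
  have h1 := partitionEntropy_itinerary_le hT hp μ n
  have h2 := partitionEntropy_nonneg μ (itinerary T p n)
  have h3 := h.abs_integral_le n μ
  rw [freeEnergy, add_mul]
  refine (abs_add_le _ _).trans (add_le_add ?_ h3)
  rwa [abs_of_nonneg h2]

/-- Since `p` is continuous into a discrete space, itinerary classes are clopen, and their masses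
are weakly continuous. -/
theorem continuous_freeEnergy [CompactSpace Ω] [HasOuterApproxClosed Ω] (n : ℕ) :
    Continuous fun μ : ProbabilityMeasure Ω => freeEnergy T p Φ n μ := by
  refine Continuous.add ?_ ?_
  · refine continuous_finsetSum _ fun i _ => Real.continuous_negMulLog.comp ?_
    refine continuous_iff_continuousAt.2 fun μ => ?_
    have hcl : IsClopen (itinerary T p n ⁻¹' {i}) :=
      (isClopen_discrete {i}).preimage (continuous_itinerary hT hp n)
    have := ProbabilityMeasure.tendsto_measure_of_isClopen_of_tendsto
      (tendsto_id (x := 𝓝 μ)) hcl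
    exact (NNReal.continuous_coe.tendsto _).comp this
  · exact ProbabilityMeasure.continuous_integral_boundedContinuousFunction
      (BoundedContinuousFunction.mkOfCompact ⟨Φ n, h.continuous n⟩)

/-- The normalised free energy of an invariant measure converges. -/
theorem tendsto_freeEnergy_div {μ : Measure Ω} [IsProbabilityMeasure μ]
    (hμ : MeasurePreserving T μ μ) :
    Tendsto (fun n : ℕ => freeEnergy T p Φ n μ / n) atTop
      (𝓝 (⨅ n : ℕ, freeEnergy T p Φ (n + 1) μ / (n + 1 : ℕ))) := by
  have hs : Subadditive fun n => freeEnergy T p Φ n μ := fun m n => by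
    simpa [(hμ.iterate m).map_eq] using h.freeEnergy_add_le hT hp μ m n
  have hb : BddBelow (Set.range fun n : ℕ => freeEnergy T p Φ n μ / n) := by
    refine ⟨-(Real.log k + C), ?_⟩
    rintro _ ⟨n, rfl⟩
    -- At n = 0 the quotient is 0 by convention; the bound at n = 1 shows that log k + C ≥ 0.
    rcases n.eq_zero_or_pos with rfl | hn
    · have := (abs_nonneg _).trans (h.abs_freeEnergy_le hT hp μ 1)
      simp only [Nat.cast_one, mul_one] at this
      simpa only [Nat.cast_zero, div_zero, Left.neg_nonpos_iff] using this
    · have hn' : (0 : ℝ) < n := by exact_mod_cast hn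
      rw [le_div_iff₀ hn']
      have := (abs_le.1 (h.abs_freeEnergy_le hT hp μ n)).1
      linarith
  -- Fekete's limit is the infimum over n ≥ 1, reindexed here by n + 1.
  convert hs.tendsto_lim hb using 2
  rw [Subadditive.lim, iInf]
  congr 1
  ext x
  constructor
  · rintro ⟨n, rfl⟩
    exact ⟨n + 1, by simp, rfl⟩
  · rintro ⟨n, hn, rfl⟩
    obtain ⟨n, rfl⟩ := Nat.exists_eq_add_of_le' (Set.mem_Ici.1 hn)
    exact ⟨n, rfl⟩

end IsSubadditiveCocycle

end FreeEnergy

/-! ### Averaging along orbits. -/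

section Averages

/-- Slide a window of length q from 0 to r = n - q: moving it from m to m + 1 changes its sum by a 0
(m + q) - a 0 m ≤ a m q. Replacing the last window by q copies of a 0 n, bounding the first one, and
extending the sum from r to n terms each cost D q². -/
theorem subadditive_averaging {a : ℕ → ℕ → ℝ} {D : ℝ}
    (hsub : ∀ i m n, a i (m + n) ≤ a i m + a (i + m) n) (hD : ∀ i n, |a i n| ≤ D * n)
    {q n : ℕ} (hqn : q ≤ n) :
    q * a 0 n ≤ ∑ i ∈ Finset.range n, a i q + 3 * D * q ^ 2 := by
  obtain ⟨r, rfl⟩ := Nat.exists_eq_add_of_le' hqn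
  have hD0 : 0 ≤ D := by simpa using (abs_nonneg _).trans (hD 0 1)
  have tel : ∀ m, ∑ j ∈ Finset.range q, a 0 (m + j) ≤
      ∑ j ∈ Finset.range q, a 0 j + ∑ i ∈ Finset.range m, a i q := by
    intro m
    induction m with
    | zero => simp
    | succ m ih =>
      have e : ∑ j ∈ Finset.range q, a 0 (m + 1 + j) + a 0 m =
          ∑ j ∈ Finset.range q, a 0 (m + j) + a 0 (m + q) := by
        rw [← Finset.sum_range_succ (fun j => a 0 (m + j)),
          Finset.sum_range_succ' (fun j => a 0 (m + j))]
        simp only [add_zero, add_assoc, add_comm 1]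
      have := hsub 0 m q
      rw [Finset.sum_range_succ]
      simp only [zero_add] at this
      linarith
  have h1 : (q : ℝ) * a 0 (r + q) ≤ ∑ j ∈ Finset.range q, a 0 (r + j) + D * q ^ 2 := by
    have : ∑ j ∈ Finset.range q, a 0 (r + q) ≤ ∑ j ∈ Finset.range q, (a 0 (r + j) + D * q) := by
      refine Finset.sum_le_sum fun j hj => ?_
      have hj' := (Finset.mem_range.1 hj).le
      have h2 := hsub 0 (r + j) (q - j)
      rw [add_assoc, Nat.add_sub_cancel' hj'] at h2
      have h3 := (abs_le.1 (hD (0 + (r + j)) (q - j))).2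
      have h4 : D * ((q - j : ℕ) : ℝ) ≤ D * q :=
        mul_le_mul_of_nonneg_left (by exact_mod_cast Nat.sub_le q j) hD0
      linarith
    rw [Finset.sum_add_distrib] at this
    simp only [Finset.sum_const, Finset.card_range, nsmul_eq_mul] at this
    linarith
  have h2 : ∑ j ∈ Finset.range q, a 0 j ≤ D * q ^ 2 := by
    have : ∑ j ∈ Finset.range q, a 0 j ≤ ∑ j ∈ Finset.range q, D * q := by
      refine Finset.sum_le_sum fun j hj => (abs_le.1 (hD 0 j)).2.trans ?_
      exact mul_le_mul_of_nonneg_left (by exact_mod_cast (Finset.mem_range.1 hj).le) hD0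
    simp only [Finset.sum_const, Finset.card_range, nsmul_eq_mul] at this
    linarith
  have h3 : ∑ i ∈ Finset.range r, a i q ≤ ∑ i ∈ Finset.range (r + q), a i q + D * q ^ 2 := by
    rw [Finset.sum_range_add]
    have : ∑ j ∈ Finset.range q, -(D * q) ≤ ∑ j ∈ Finset.range q, a (r + j) q :=
      Finset.sum_le_sum fun j _ => (abs_le.1 (hD (r + j) q)).1
    simp only [Finset.sum_const, Finset.card_range, nsmul_eq_mul] at this
    linarith
  have := tel r
  linarith

variable {Ω : Type*} [MeasurableSpace Ω]

/-- The average of the first `n` push-forwards of `σ` under `T`. -/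
noncomputable def orbitAverage (T : Ω → Ω) (σ : Measure Ω) (n : ℕ) : Measure Ω :=
  (n : ℝ≥0∞)⁻¹ • ∑ i ∈ Finset.range n, σ.map T^[i]

variable {T : Ω → Ω}

theorem integral_orbitAverage (σ : Measure Ω) {f : Ω → ℝ} (hf : ∀ i, Integrable f (σ.map T^[i])) (n : ℕ) :
    ∫ ω, f ω ∂(orbitAverage T σ n) =
      ∑ i ∈ Finset.range n, (n : ℝ)⁻¹ * ∫ ω, f ω ∂(σ.map T^[i]) := by
  rw [orbitAverage, integral_smul_measure, integral_finsetSum_measure fun i _ => hf i,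
    Finset.smul_sum]
  simp

variable (hT : Measurable T) (σ : Measure Ω) [IsProbabilityMeasure σ]
include hT

theorem isProbabilityMeasure_orbitAverage {n : ℕ} (hn : n ≠ 0) :
    IsProbabilityMeasure (orbitAverage T σ n) := by
  have : ∀ i, IsProbabilityMeasure (σ.map T^[i]) := fun i =>
    Measure.isProbabilityMeasure_map (hT.iterate i).aemeasurable
  refine ⟨?_⟩
  rw [orbitAverage, Measure.smul_apply, Measure.finsetSum_apply]
  simp only [measure_univ, Finset.sum_const, Finset.card_range, smul_eq_mul, nsmul_eq_mul, mul_one]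
  exact ENNReal.inv_mul_cancel (by exact_mod_cast hn) (ENNReal.natCast_ne_top n)

theorem measureReal_orbitAverage (n : ℕ) {s : Set Ω} (hs : MeasurableSet s) :
    (orbitAverage T σ n).real s =
      ∑ i ∈ Finset.range n, (n : ℝ)⁻¹ * (σ.map T^[i]).real s := by
  have : ∀ i, IsProbabilityMeasure (σ.map T^[i]) := fun i =>
    Measure.isProbabilityMeasure_map (hT.iterate i).aemeasurable
  have := integral_orbitAverage (T := T) σ (f := s.indicator 1)
    (fun i => (integrable_const (1 : ℝ)).indicator hs) n
  simpa only [integral_indicator_one hs] using this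

/-- The difference telescopes to its two end terms, so weak limits of orbit averages are invariant.
-/
theorem abs_integral_comp_orbitAverage_sub_le {f : Ω → ℝ} (hf : Measurable f) {B : ℝ}
    (hB : ∀ ω, |f ω| ≤ B) (n : ℕ) :
    |∫ ω, f ω ∂((orbitAverage T σ n).map T) - ∫ ω, f ω ∂(orbitAverage T σ n)| ≤ 2 * B / n := by
  have hpr : ∀ i, IsProbabilityMeasure (σ.map T^[i]) := fun i =>
    Measure.isProbabilityMeasure_map (hT.iterate i).aemeasurable
  have hi : ∀ i, Integrable f (σ.map T^[i]) := fun i =>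
    Integrable.of_bound hf.aestronglyMeasurable B (ae_of_all _ hB)
  have hmap : ∀ i, ∫ ω, f (T ω) ∂(σ.map T^[i]) = ∫ ω, f ω ∂(σ.map T^[i + 1]) := fun i => by
    rw [Function.iterate_succ', ← Measure.map_map hT (hT.iterate i),
      integral_map hT.aemeasurable hf.aestronglyMeasurable]
  have hb : ∀ i, |∫ ω, f ω ∂(σ.map T^[i])| ≤ B := fun i => by
    have := norm_integral_le_of_norm_le_const (μ := σ.map T^[i]) (f := f) (ae_of_all _ hB)
    simpa using this
  rw [integral_map hT.aemeasurable hf.aestronglyMeasurable, integral_orbitAverage σ hi,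
    integral_orbitAverage σ (f := fun ω => f (T ω)) (fun i => Integrable.of_bound (hf.comp hT).aestronglyMeasurable B
      (ae_of_all _ fun ω => hB (T ω))), ← Finset.sum_sub_distrib]
  simp only [hmap, ← mul_sub]
  rw [← Finset.mul_sum, Finset.sum_range_sub (fun i => ∫ ω, f ω ∂(σ.map T^[i])), abs_mul,
    abs_of_nonneg (by positivity), inv_mul_eq_div]
  refine div_le_div_of_nonneg_right ?_ (by positivity)
  have h1 := abs_le.1 (hb n)
  have h2 := abs_le.1 (hb 0)
  exact abs_le.2 ⟨by linarith, by linarith⟩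

end Averages

section

variable {Ω : Type*} [TopologicalSpace Ω] [MeasurableSpace Ω] [BorelSpace Ω] {k : ℕ}
  {T : Ω → Ω} {Φ : ℕ → Ω → ℝ} {C : ℝ}

/-- `subadditive_averaging` along the push-forwards of σ; concavity of entropy and linearity of the
integral then bring the average inside the free energy. -/
theorem IsSubadditiveCocycle.mul_freeEnergy_le_orbitAverage (h : IsSubadditiveCocycle T Φ C)
    (hT : Continuous T) {p : Ω → Fin k} (hp : Continuous p) (σ : Measure Ω)
    [IsProbabilityMeasure σ] {q n : ℕ} (hqn : q ≤ n) (hn : n ≠ 0) :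
    q * freeEnergy T p Φ n σ ≤
      n * freeEnergy T p Φ q (orbitAverage T σ n) + 3 * (Real.log k + C) * q ^ 2 := by
  have hpr : ∀ i, IsProbabilityMeasure (σ.map T^[i]) := fun i =>
    Measure.isProbabilityMeasure_map (hT.iterate i).measurable.aemeasurable
  have h1 := subadditive_averaging (a := fun i m => freeEnergy T p Φ m (σ.map T^[i]))
    (D := Real.log k + C) (fun i m n => by
      have := h.freeEnergy_add_le hT hp (σ.map T^[i]) m n
      rwa [Measure.map_map (hT.iterate m).measurable (hT.iterate i).measurable,
        ← Function.iterate_add, add_comm m i] at this)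
    (fun i n => h.abs_freeEnergy_le hT hp _ n) hqn
  have hn' : (0 : ℝ) < n := by exact_mod_cast Nat.pos_of_ne_zero hn
  have h2 : ∑ i ∈ Finset.range n, (n : ℝ)⁻¹ * freeEnergy T p Φ q (σ.map T^[i]) ≤
      freeEnergy T p Φ q (orbitAverage T σ n) := by
    simp only [freeEnergy, mul_add, Finset.sum_add_distrib]
    refine add_le_add ?_ (integral_orbitAverage σ (fun i => h.integrable q _) n).ge
    refine sum_mul_partitionEntropy_le _ (fun _ _ => by positivity) (by simp [hn]) _ _ _ fun i => ?_
    exact measureReal_orbitAverage hT.measurable σ n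
      ((continuous_itinerary hT hp q).measurable (measurableSet_singleton i))
  rw [← Finset.mul_sum, inv_mul_le_iff₀ hn'] at h2
  simp only [Function.iterate_zero, Measure.map_id] at h1
  linarith

end

/-! ### Reverse Fatou for bounded real functions. -/

section ReverseFatou

variable {Ω : Type*} [MeasurableSpace Ω] {μ : Measure Ω} {f : ℕ → Ω → ℝ} {B : ℝ}

theorem abs_limsup_le {u : ℕ → ℝ} (hB : ∀ n, |u n| ≤ B) : |limsup u atTop| ≤ B := by
  have hbdd : IsBoundedUnder (· ≤ ·) atTop u := isBoundedUnder_of ⟨B, fun n => (abs_le.1 (hB n)).2⟩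
  have hbdd' : IsBoundedUnder (· ≥ ·) atTop u :=
    isBoundedUnder_of ⟨-B, fun n => (abs_le.1 (hB n)).1⟩
  refine abs_le.2 ⟨?_, ?_⟩
  · exact le_limsup_of_frequently_le (Frequently.of_forall fun n => (abs_le.1 (hB n)).1) hbdd
  · exact limsup_le_of_le hbdd'.isCoboundedUnder_le
      (Eventually.of_forall fun n => (abs_le.1 (hB n)).2)

theorem integrable_limsup_of_bound [IsFiniteMeasure μ] (hf : ∀ n, Measurable (f n))
    (hB : ∀ n ω, |f n ω| ≤ B) : Integrable (fun ω => limsup (fun n => f n ω) atTop) μ :=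
  Integrable.of_bound (Measurable.limsup hf).aestronglyMeasurable B
    (ae_of_all _ fun ω => abs_limsup_le fun n => hB n ω)

/-- Reverse Fatou lemma for uniformly bounded functions. -/
theorem le_integral_limsup [IsProbabilityMeasure μ] (hf : ∀ n, Measurable (f n))
    (hB : ∀ n ω, |f n ω| ≤ B) {b : ℕ → ℝ} {b₀ : ℝ} (hb : Tendsto b atTop (𝓝 b₀))
    (hle : ∀ n, b n ≤ ∫ ω, f n ω ∂μ) :
    b₀ ≤ ∫ ω, limsup (fun n => f n ω) atTop ∂μ := by
  have hbdd : ∀ ω, IsBoundedUnder (· ≤ ·) atTop fun n => f n ω := fun ω =>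
    isBoundedUnder_of ⟨B, fun n => (abs_le.1 (hB n ω)).2⟩
  have hbdd' : ∀ ω, IsBoundedUnder (· ≥ ·) atTop fun n => f n ω := fun ω =>
    isBoundedUnder_of ⟨-B, fun n => (abs_le.1 (hB n ω)).1⟩
  have hL : ∀ ω, |limsup (fun n => f n ω) atTop| ≤ B := fun ω => abs_limsup_le fun n => hB n ω
  have hLi : Integrable (fun ω => limsup (fun n => f n ω) atTop) μ :=
    integrable_limsup_of_bound hf hB
  have hfi : ∀ n, Integrable (f n) μ := fun n =>
    Integrable.of_bound (hf n).aestronglyMeasurable B (ae_of_all _ (hB n))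
  -- Adding B makes everything nonnegative, which transfers the question to lower Lebesgue
  -- integrals.
  have key : ∀ g : Ω → ℝ, Integrable g μ → (∀ ω, |g ω| ≤ B) →
      ∫⁻ ω, ENNReal.ofReal (g ω + B) ∂μ = ENNReal.ofReal (∫ ω, g ω ∂μ + B) := by
    intro g hg hgB
    have hnn : ∀ ω, 0 ≤ g ω + B := fun ω => by linarith [(abs_le.1 (hgB ω)).1]
    rw [← ofReal_integral_eq_lintegral_ofReal (f := fun ω => g ω + B)
      (hg.add (integrable_const B)) (ae_of_all _ hnn), integral_add hg (integrable_const B)]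
    simp
  have hfatou := limsup_lintegral_le (μ := μ) (f := fun n ω => ENNReal.ofReal (f n ω + B))
    (fun _ => ENNReal.ofReal (B + B)) (fun n => ((hf n).add_const B).ennreal_ofReal)
    (fun n => ae_of_all _ fun ω => ENNReal.ofReal_le_ofReal
      (by linarith [(abs_le.1 (hB n ω)).2])) (by simp)
  have hcomm : ∀ ω, limsup (fun n => ENNReal.ofReal (f n ω + B)) atTop =
      ENNReal.ofReal (limsup (fun n => f n ω) atTop + B) := by
    intro ω
    have hmono : Monotone fun y : ℝ => ENNReal.ofReal (y + B) := fun y z hyz =>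
      ENNReal.ofReal_le_ofReal (by linarith)
    exact (hmono.map_limsup_of_continuousAt (F := atTop) (fun n => f n ω)
      (ENNReal.continuous_ofReal.comp (continuous_add_const B)).continuousAt (hbdd ω)
      (hbdd' ω).isCoboundedUnder_le).symm
  simp only [hcomm] at hfatou
  rw [key _ hLi hL] at hfatou
  have hlim : Tendsto (fun n => ENNReal.ofReal (b n + B)) atTop (𝓝 (ENNReal.ofReal (b₀ + B))) :=
    ENNReal.tendsto_ofReal (hb.add_const B)
  have h1 : ENNReal.ofReal (b₀ + B) ≤
      ENNReal.ofReal (∫ ω, limsup (fun n => f n ω) atTop ∂μ + B) := by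
    rw [← hlim.limsup_eq]
    refine le_trans (limsup_le_limsup (Eventually.of_forall fun n => ?_)) hfatou
    simp only
    rw [key _ (hfi n) (hB n)]
    exact ENNReal.ofReal_le_ofReal (by linarith [hle n])
  have h2 : 0 ≤ ∫ ω, limsup (fun n => f n ω) atTop ∂μ + B := by
    have := norm_integral_le_of_norm_le_const (μ := μ)
      (f := fun ω => limsup (fun n => f n ω) atTop) (ae_of_all _ hL)
    have := (abs_le.1 this).1
    simp at this
    linarith
  linarith [(ENNReal.ofReal_le_ofReal_iff h2).1 h1]

end ReverseFatou

/-! ### The subadditive variational principle. -/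

section Variational

variable {Ω : Type*} [MetricSpace Ω] [MeasurableSpace Ω] [BorelSpace Ω] {k : ℕ}
  {T : Ω → Ω} {Φ : ℕ → Ω → ℝ} {C : ℝ}

/-- The Gibbs weights on a finite set of points with distinct itineraries realise the
partition sum. -/
theorem exists_freeEnergy_eq_log_sum_exp {W : Type*} [Fintype W] [Nonempty W] (hT : Continuous T)
    {p : Ω → Fin k} (hp : Continuous p) {n : ℕ} (x : W → Ω)
    (hx : Function.Injective fun w => itinerary T p n (x w)) :
    ∃ σ : Measure Ω, IsProbabilityMeasure σ ∧
      freeEnergy T p Φ n σ = Real.log (∑ w, Real.exp (Φ n (x w))) := by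
  classical
  set Z := ∑ w, Real.exp (Φ n (x w)) with hZ
  have hZ0 : 0 < Z := Finset.sum_pos (fun _ _ => Real.exp_pos _) Finset.univ_nonempty
  set P : W → ℝ := fun w => Real.exp (Φ n (x w)) / Z with hP
  have hP0 : ∀ w, 0 ≤ P w := fun w => by positivity
  have hP1 : ∑ w, P w = 1 := by rw [← Finset.sum_div, div_self hZ0.ne']
  have hint : ∀ f : Ω → ℝ, ∫ ω, f ω ∂(∑ w, ENNReal.ofReal (P w) • Measure.dirac (x w)) =
      ∑ w, P w * f (x w) := by
    intro f
    rw [integral_finsetSum_measure fun w _ =>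
      (integrable_dirac (by simp)).smul_measure ENNReal.ofReal_ne_top]
    refine Finset.sum_congr rfl fun w _ => ?_
    rw [integral_smul_measure, integral_dirac, ENNReal.toReal_ofReal (hP0 w), smul_eq_mul]
  have hσ : IsProbabilityMeasure (∑ w, ENNReal.ofReal (P w) • Measure.dirac (x w)) := by
    refine ⟨?_⟩
    rw [Measure.finsetSum_apply]
    simp only [Measure.smul_apply, measure_univ, smul_eq_mul, mul_one]
    rw [← ENNReal.ofReal_sum_of_nonneg fun w _ => hP0 w, hP1, ENNReal.ofReal_one]
  refine ⟨_, hσ, ?_⟩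
  set σ := ∑ w, ENNReal.ofReal (P w) • Measure.dirac (x w) with hσdef
  have hreal : ∀ i, σ.real (itinerary T p n ⁻¹' {i}) =
      ∑ w, if itinerary T p n (x w) = i then P w else 0 := by
    intro i
    have hm : MeasurableSet (itinerary T p n ⁻¹' {i}) :=
      (continuous_itinerary hT hp n).measurable (measurableSet_singleton i)
    rw [← integral_indicator_one hm, hint]
    refine Finset.sum_congr rfl fun w _ => ?_
    by_cases h : itinerary T p n (x w) = i <;> simp [h]
  -- By injectivity each itinerary class contains at most one atom, so its entropy term is that of a
  -- single weight or zero.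
  have hH : partitionEntropy σ (itinerary T p n) = ∑ w, Real.negMulLog (P w) := by
    rw [partitionEntropy]
    symm
    refine Finset.sum_of_injOn (fun w => itinerary T p n (x w)) hx.injOn (by simp) ?_ ?_
    · intro i _ hi
      rw [hreal, Finset.sum_eq_zero, Real.negMulLog_zero]
      intro w _
      rw [if_neg]
      rintro rfl
      exact hi ⟨w, by simp, rfl⟩
    · intro w _
      rw [hreal, Finset.sum_eq_single w, if_pos rfl]
      · intro w' _ hw'
        rw [if_neg]
        exact fun h => hw' (hx h)
      · simp
  rw [freeEnergy, hH, hint, ← Finset.sum_add_distrib]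
  -- For Gibbs weights, -log P + Φ_n is the constant log Z.
  have : ∀ w, Real.negMulLog (P w) + P w * Φ n (x w) = P w * Real.log Z := by
    intro w
    rw [Real.negMulLog, hP]
    simp only
    rw [Real.log_div (Real.exp_pos _).ne' hZ0.ne', Real.log_exp]
    ring
  simp only [this]
  rw [← Finset.sum_mul, hP1, one_mul]

namespace IsSubadditiveCocycle

omit [MeasurableSpace Ω] [BorelSpace Ω] in
theorem abs_div_le (h : IsSubadditiveCocycle T Φ C) (n : ℕ) (ω : Ω) : |Φ n ω / n| ≤ C := by
  rcases n.eq_zero_or_pos with rfl | hn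
  · simpa using (abs_nonneg _).trans (h.bound 1 ω)
  · have hn' : (0 : ℝ) < n := by exact_mod_cast hn
    rw [abs_div, abs_of_pos hn', div_le_iff₀ hn']
    exact h.bound n ω

theorem integrable_limsup (h : IsSubadditiveCocycle T Φ C) (ν : Measure Ω) [IsFiniteMeasure ν] :
    Integrable (fun ω => limsup (fun n : ℕ => Φ n ω / n) atTop) ν :=
  integrable_limsup_of_bound (fun n => (h.continuous n).measurable.div_const _) h.abs_div_le

variable (h : IsSubadditiveCocycle T Φ C) (hT : Continuous T) {p : Ω → Fin k} (hp : Continuous p)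
include h hT hp

/-- Divide the hypothesis by q: the entropy part tends to a limit η ≤ h_ν(T), so c - H_q / q, which
tends to c - η, bounds ∫ Φ_q / q from below, and reverse Fatou applies. -/
theorem le_ksEntropy_add_integral_limsup {ν : Measure Ω} [IsProbabilityMeasure ν]
    (hν : MeasurePreserving T ν ν) {c : ℝ} (hc : ∀ q : ℕ, c * q ≤ freeEnergy T p Φ q ν) :
    (c : EReal) ≤ ksEntropy T ν +
      ((∫ ω, limsup (fun n : ℕ => Φ n ω / n) atTop ∂ν : ℝ) : EReal) := by
  -- For the zero cocycle the free energy is the entropy alone.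
  have h0 : IsSubadditiveCocycle T (fun _ _ => 0) 0 :=
    ⟨fun _ => continuous_const, fun _ _ _ => by simp, fun _ _ => by simp⟩
  have hH := h0.tendsto_freeEnergy_div hT hp hν
  simp only [freeEnergy, integral_zero, add_zero] at hH
  set η := ⨅ n : ℕ, partitionEntropy ν (itinerary T p (n + 1)) / (n + 1 : ℕ) with hη
  have hks : (η : EReal) ≤ ksEntropy T ν := by
    have : limsup (fun n : ℕ => ((partitionEntropy ν (itinerary T p n) / n : ℝ) : EReal)) atTop
        = η := ((continuous_coe_real_ereal.tendsto _).comp hH).limsup_eq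
    rw [← this]
    exact le_iSup_of_le k (le_iSup_of_le p (le_iSup_of_le hp.measurable le_rfl))
  have hmain := le_integral_limsup (μ := ν) (f := fun n ω => Φ n ω / n)
    (b := fun n => if n = 0 then 0 else c - partitionEntropy ν (itinerary T p n) / n)
    (b₀ := c - η) (fun n => (h.continuous n).measurable.div_const _) h.abs_div_le
    ((hH.const_sub c).congr' (by
      filter_upwards [eventually_ne_atTop 0] with n hn
      rw [if_neg hn])) fun n => by
    rcases n.eq_zero_or_pos with rfl | hn
    · simp
    · have hn' : (0 : ℝ) < n := by exact_mod_cast hn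
      rw [if_neg hn.ne', integral_div, sub_le_iff_le_add, ← add_div, le_div_iff₀ hn', add_comm]
      exact hc n
  calc (c : EReal) ≤ ((η + ∫ ω, limsup (fun n : ℕ => Φ n ω / n) atTop ∂ν : ℝ) : EReal) := by
        exact_mod_cast (by linarith)
    _ ≤ _ := by
        rw [EReal.coe_add]
        exact add_le_add_left hks _

variable [CompactSpace Ω]

/-- Krylov–Bogolyubov along the good times n: orbit averages of the given measures accumulate at an
invariant measure, and the averaging inequality carries the bound from scale n to every fixed scale
q. -/
theorem exists_measurePreserving_forall_le {c : ℝ}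
    (hc : ∃ᶠ n : ℕ in atTop, ∃ σ : Measure Ω, IsProbabilityMeasure σ ∧
      c * n ≤ freeEnergy T p Φ n σ) :
    ∃ ν : ProbabilityMeasure Ω, MeasurePreserving T (ν : Measure Ω) ν ∧
      ∀ q : ℕ, c * q ≤ freeEnergy T p Φ q ν := by
  obtain ⟨-, σ₀, hσ₀, -⟩ := hc.exists
  let good : Set ℕ := {n | ∃ σ : Measure Ω, IsProbabilityMeasure σ ∧ c * n ≤ freeEnergy T p Φ n σ}
  have hchoice : ∀ n : ℕ, ∃ σ : ProbabilityMeasure Ω, n ∈ good →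
      c * n ≤ freeEnergy T p Φ n σ := by
    intro n
    by_cases hn : n ∈ good
    · obtain ⟨σ, hσ, hle⟩ := hn
      exact ⟨⟨σ, hσ⟩, fun _ => hle⟩
    · exact ⟨⟨σ₀, hσ₀⟩, fun h => absurd h hn⟩
  choose σ hσ using hchoice
  have hchoice' : ∀ n : ℕ, ∃ μ : ProbabilityMeasure Ω, n ≠ 0 →
      (μ : Measure Ω) = orbitAverage T (σ n) n := by
    intro n
    by_cases hn : n = 0
    · exact ⟨σ n, fun h => absurd hn h⟩
    · exact ⟨⟨_, isProbabilityMeasure_orbitAverage hT.measurable (σ n) hn⟩, fun _ => rfl⟩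
  choose μ hμ using hchoice'
  have hne : NeBot (atTop ⊓ 𝓟 good) := inf_principal_neBot_iff.2 fun s hs => by
    obtain ⟨n, hn⟩ := (hc.and_eventually hs).exists
    exact ⟨n, hn.2, hn.1⟩
  -- An ultrafilter on the good times tending to infinity plays the role of a convergent
  -- subsequence.
  let U : Ultrafilter ℕ := Ultrafilter.of (atTop ⊓ 𝓟 good)
  have hUle : (U : Filter ℕ) ≤ atTop ⊓ 𝓟 good := Ultrafilter.of_le _
  have hU1 : (U : Filter ℕ) ≤ atTop := hUle.trans inf_le_left
  have hU2 : ∀ᶠ n in (U : Filter ℕ), n ∈ good := (hUle.trans inf_le_right) (mem_principal_self _)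
  obtain ⟨ν, -, hν⟩ := isCompact_univ.ultrafilter_le_nhds (U.map μ) (by simp)
  have hν' : Tendsto μ U (𝓝 ν) := hν
  refine ⟨ν, ?_, fun q => ?_⟩
  · have h1 : Tendsto (fun n => (μ n).map hT.aemeasurable) U (𝓝 (ν.map hT.aemeasurable)) :=
      ((ProbabilityMeasure.continuous_map hT).tendsto ν).comp hν'
    have h2 : Tendsto (fun n => (μ n).map hT.aemeasurable) U (𝓝 ν) := by
      rw [ProbabilityMeasure.tendsto_iff_forall_integral_tendsto] at hν' ⊢
      intro f
      have hdiff : Tendsto (fun n => ∫ ω, f ω ∂((μ n).map hT.aemeasurable : Measure Ω)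
          - ∫ ω, f ω ∂(μ n : Measure Ω)) U (𝓝 0) := by
        refine squeeze_zero_norm' (a := fun n : ℕ => 2 * ‖f‖ / n) ?_
          ((tendsto_const_div_atTop_nhds_zero_nat (2 * ‖f‖)).mono_left hU1)
        filter_upwards [hU1 (eventually_ne_atTop 0)] with n hn
        rw [ProbabilityMeasure.toMeasure_map, hμ n hn]
        exact abs_integral_comp_orbitAverage_sub_le hT.measurable _ f.continuous.measurable
          (fun ω => f.norm_coe_le_norm ω) n
      simpa using hdiff.add (hν' f)
    refine ⟨hT.measurable, ?_⟩
    have := congrArg (fun κ : ProbabilityMeasure Ω => (κ : Measure Ω)) (tendsto_nhds_unique h1 h2)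
    simpa using this
  · have h1 : Tendsto (fun n : ℕ => freeEnergy T p Φ q (μ n)
        + 3 * (Real.log k + C) * q ^ 2 / n) U (𝓝 (freeEnergy T p Φ q ν + 0)) :=
      (((h.continuous_freeEnergy hT hp q).tendsto ν).comp hν').add
        ((tendsto_const_div_atTop_nhds_zero_nat _).mono_left hU1)
    rw [add_zero] at h1
    -- After division by n, the averaging error 3(log k + C)q² becomes negligible.
    refine ge_of_tendsto h1 ?_
    filter_upwards [hU2, hU1 (eventually_ne_atTop 0), hU1 (eventually_ge_atTop q)] with n hg hn hq
    have h2 := h.mul_freeEnergy_le_orbitAverage hT hp (σ n) hq hn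
    have hn' : (0 : ℝ) < n := by exact_mod_cast Nat.pos_of_ne_zero hn
    have h3 := mul_le_mul_of_nonneg_left (hσ n hg) (Nat.cast_nonneg (α := ℝ) q)
    rw [hμ n hn, ← sub_le_iff_le_add', le_div_iff₀ hn', sub_mul]
    linarith

omit [CompactSpace Ω] in
-- The error does not depend on n, so it disappears from the limit of the free energy divided by n.
theorem freeEnergy_convexComb_le {μ ν₁ ν₂ : Measure Ω} [IsProbabilityMeasure ν₁]
    [IsProbabilityMeasure ν₂] {a b : ℝ≥0∞} (ha : a ≠ ∞) (hb : b ≠ ∞)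
    (hμ : a • ν₁ + b • ν₂ = μ) (n : ℕ) :
    freeEnergy T p Φ n μ ≤ a.toReal * freeEnergy T p Φ n ν₁ + b.toReal * freeEnergy T p Φ n ν₂
      + (Real.negMulLog a.toReal + Real.negMulLog b.toReal) := by
  have h1 := partitionEntropy_convexComb_le (ν := μ) (μ₁ := ν₁) (μ₂ := ν₂)
    (ENNReal.toReal_nonneg (a := a)) (ENNReal.toReal_nonneg (a := b))
    (continuous_itinerary hT hp n).measurable fun i => by
      have := Measure.smul_finite ν₁ ha
      have := Measure.smul_finite ν₂ hb
      rw [← hμ, measureReal_add_apply]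
      simp
  have h2 : ∫ ω, Φ n ω ∂μ = a.toReal * ∫ ω, Φ n ω ∂ν₁ + b.toReal * ∫ ω, Φ n ω ∂ν₂ := by
    rw [← hμ, integral_add_measure ((h.integrable n ν₁).smul_measure ha)
      ((h.integrable n ν₂).smul_measure hb), integral_smul_measure, integral_smul_measure]
    rfl
  rw [freeEnergy, h2]
  simp only [freeEnergy]
  linarith

/-- A lower bound for the free energy of an invariant measure is also attained by an ergodic
one. -/
theorem exists_ergodic_forall_le {c : ℝ} {ν₀ : ProbabilityMeasure Ω}
    (hν₀ : MeasurePreserving T (ν₀ : Measure Ω) ν₀)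
    (hc : ∀ q : ℕ, c * q ≤ freeEnergy T p Φ q ν₀) :
    ∃ ν : Measure Ω, IsProbabilityMeasure ν ∧ Ergodic T ν ∧
      ∀ q : ℕ, c * q ≤ freeEnergy T p Φ q ν := by
  let G : ProbabilityMeasure Ω → ℝ := fun ν =>
    ⨅ n : ℕ, freeEnergy T p Φ (n + 1) ν / (n + 1 : ℕ)
  let M : Set (ProbabilityMeasure Ω) := {ν | ν.map hT.aemeasurable = ν}
  have hM : ∀ ν : ProbabilityMeasure Ω, ν ∈ M ↔ MeasurePreserving T (ν : Measure Ω) ν := by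
    intro ν
    constructor
    · intro hν
      refine ⟨hT.measurable, ?_⟩
      simpa using congrArg (fun κ : ProbabilityMeasure Ω => (κ : Measure Ω)) hν
    · intro hν
      apply ProbabilityMeasure.toMeasure_injective
      simpa using hν.map_eq
  have hMc : IsClosed M := isClosed_eq (ProbabilityMeasure.continuous_map hT) continuous_id
  have hbdd : ∀ ν : ProbabilityMeasure Ω,
      BddBelow (Set.range fun n : ℕ => freeEnergy T p Φ (n + 1) ν / (n + 1 : ℕ)) := by
    intro ν
    refine ⟨-(Real.log k + C), ?_⟩
    rintro _ ⟨n, rfl⟩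
    simp only
    rw [le_div_iff₀ (by positivity)]
    have := (_root_.abs_le.1 (h.abs_freeEnergy_le hT hp ν (n + 1))).1
    linarith
  have hG : UpperSemicontinuous G := upperSemicontinuous_ciInf hbdd fun n =>
    ((h.continuous_freeEnergy hT hp (n + 1)).div_const _).upperSemicontinuous
  obtain ⟨ν₁, hν₁, hmax⟩ := (hG.upperSemicontinuousOn M).exists_isMaxOn
    ⟨ν₀, (hM ν₀).2 hν₀⟩ hMc.isCompact
  -- The maximisers of G among invariant measures; compact by upper semicontinuity.
  let K : Set (ProbabilityMeasure Ω) := M ∩ G ⁻¹' Set.Ici (G ν₁)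
  have hK : IsCompact K := (hMc.inter (hG.isClosed_preimage _)).isCompact
  -- Embeds measures into a locally convex space, where a nonempty compact set has an extreme point.
  let J : ProbabilityMeasure Ω → C(Ω, ℝ) → ℝ := fun ν f => ∫ ω, f ω ∂(ν : Measure Ω)
  have hJ : Continuous J :=
    continuous_pi fun f => ProbabilityMeasure.continuous_integral_continuousMap f
  have hJi : Function.Injective J := by
    intro μ ν hμν
    apply ProbabilityMeasure.toMeasure_injective
    exact ext_of_forall_integral_eq_of_IsFiniteMeasure fun f => congrFun hμν f.toContinuousMap
  obtain ⟨x, hxmem, hxext⟩ := (hK.image hJ).extremePoints_nonempty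
    ⟨J ν₁, ν₁, ⟨hν₁, le_refl (G ν₁)⟩, rfl⟩
  obtain ⟨ν, ⟨hνM, hνG⟩, rfl⟩ := hxmem
  have hGlim : ∀ κ ∈ M, Tendsto (fun n : ℕ => freeEnergy T p Φ n κ / n) atTop (𝓝 (G κ)) :=
    fun κ hκ => h.tendsto_freeEnergy_div hT hp ((hM κ).1 hκ)
  refine ⟨ν, inferInstance, Ergodic.of_mem_extremePoints ⟨⟨(hM ν).1 hνM, inferInstance⟩, ?_⟩,
    fun q => ?_⟩
  · rintro κ₁ ⟨hκ₁, hpr₁⟩ κ₂ ⟨hκ₂, hpr₂⟩ ⟨a, b, ha, hb, hab, hν⟩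
    let l₁ : ProbabilityMeasure Ω := ⟨κ₁, hpr₁⟩
    let l₂ : ProbabilityMeasure Ω := ⟨κ₂, hpr₂⟩
    have hl₁ : l₁ ∈ M := (hM l₁).2 hκ₁
    have hl₂ : l₂ ∈ M := (hM l₂).2 hκ₂
    have ha' : a ≠ ∞ := ne_top_of_le_ne_top ENNReal.one_ne_top (hab ▸ le_self_add)
    have hb' : b ≠ ∞ := ne_top_of_le_ne_top ENNReal.one_ne_top (hab ▸ le_add_self)
    have ha0 : 0 < a.toReal := ENNReal.toReal_pos ha.ne' ha'
    have hb0 : 0 < b.toReal := ENNReal.toReal_pos hb.ne' hb'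
    have hab1 : a.toReal + b.toReal = 1 := by
      rw [← ENNReal.toReal_add ha' hb', hab, ENNReal.toReal_one]
    have hconv : G ν ≤ a.toReal * G l₁ + b.toReal * G l₂ := by
      have hlim := (((hGlim l₁ hl₁).const_mul a.toReal).add
        ((hGlim l₂ hl₂).const_mul b.toReal)).add (tendsto_const_div_atTop_nhds_zero_nat
          (Real.negMulLog a.toReal + Real.negMulLog b.toReal))
      rw [add_zero] at hlim
      refine le_of_tendsto_of_tendsto' (hGlim ν hνM) hlim fun n => ?_
      have := div_le_div_of_nonneg_right (h.freeEnergy_convexComb_le hT hp ha' hb' hν n)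
        (Nat.cast_nonneg (α := ℝ) n)
      refine this.trans (le_of_eq ?_)
      simp only [l₁, l₂, ProbabilityMeasure.coe_mk]
      ring
    have hle₁ : G l₁ ≤ G ν₁ := hmax hl₁
    have hle₂ : G l₂ ≤ G ν₁ := hmax hl₂
    have hνG' : G ν₁ ≤ G ν := hνG
    have hsum : a.toReal * G ν₁ + b.toReal * G ν₁ = G ν₁ := by rw [← add_mul, hab1, one_mul]
    -- Both values are at most the maximum and their weighted mean reaches it, so both components
    -- are maximisers.
    have hge₁ : G ν₁ ≤ G l₁ := by
      refine le_of_mul_le_mul_left ?_ ha0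
      linarith [mul_le_mul_of_nonneg_left hle₂ hb0.le]
    have hge₂ : G ν₁ ≤ G l₂ := by
      refine le_of_mul_le_mul_left ?_ hb0
      linarith [mul_le_mul_of_nonneg_left hle₁ ha0.le]
    have hseg : J ν ∈ openSegment ℝ (J l₁) (J l₂) := by
      refine ⟨a.toReal, b.toReal, ha0, hb0, hab1, ?_⟩
      funext f
      have hfi : ∀ κ : Measure Ω, IsProbabilityMeasure κ → Integrable f κ := fun κ _ =>
        (BoundedContinuousFunction.mkOfCompact f).integrable κ
      simp only [J, Pi.add_apply, Pi.smul_apply, smul_eq_mul, l₁, l₂, ProbabilityMeasure.coe_mk]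
      rw [← hν, integral_add_measure ((hfi κ₁ hpr₁).smul_measure ha')
        ((hfi κ₂ hpr₂).smul_measure hb'), integral_smul_measure, integral_smul_measure]
      rfl
    have := hJi (hxext ⟨l₁, ⟨hl₁, hge₁⟩, rfl⟩ ⟨l₂, ⟨hl₂, hge₂⟩, rfl⟩ hseg)
    exact congrArg (fun κ : ProbabilityMeasure Ω => (κ : Measure Ω)) this
  · have hcG : c ≤ G ν := by
      refine le_trans (le_ciInf fun n => ?_) ((hmax ((hM ν₀).2 hν₀)).trans hνG)
      rw [le_div_iff₀ (by positivity)]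
      exact hc (n + 1)
    rcases q with _ | q
    · have := h.abs_freeEnergy_le hT hp ν 0
      simp only [Nat.cast_zero, mul_zero] at this ⊢
      exact (abs_nonpos_iff.1 this).ge
    · rw [← le_div_iff₀ (by positivity)]
      exact hcG.trans (ciInf_le (hbdd ν) q)

end IsSubadditiveCocycle

end Variational

/-! ### Topology of the Markov shift. -/

namespace MarkovShift

variable {S : Type*} {A : S → S → Prop}

theorem isInducing_seq [TopologicalSpace S] [DiscreteTopology S] :
    Topology.IsInducing (seq : MarkovShift A → ℕ → S) := by
  obtain rfl : ‹TopologicalSpace S› = ⊥ := DiscreteTopology.eq_bot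
  let : TopologicalSpace S := ⊥
  exact ⟨rfl⟩

theorem isClosedEmbedding_seq [TopologicalSpace S] [DiscreteTopology S] :
    Topology.IsClosedEmbedding (seq : MarkovShift A → ℕ → S) := by
  refine ⟨⟨isInducing_seq, seq_injective⟩, ?_⟩
  have hr : Set.range (seq : MarkovShift A → ℕ → S) =
      ⋂ i, (fun f : ℕ → S => (f i, f (i + 1))) ⁻¹' {x | A x.1 x.2} := by
    ext f
    simp only [Set.mem_range, Set.mem_iInter, Set.mem_preimage, Set.mem_ofPred_eq]
    exact ⟨fun ⟨ω, hω⟩ i => hω ▸ ω.adm i, fun hf => ⟨⟨f, hf⟩, rfl⟩⟩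
  rw [hr]
  exact isClosed_iInter fun i => (isClosed_discrete _).preimage
    ((continuous_apply i).prodMk (continuous_apply (i + 1)))

instance [Finite S] : CompactSpace (MarkovShift A) := by
  let : TopologicalSpace S := ⊥
  have : DiscreteTopology S := ⟨rfl⟩
  exact isClosedEmbedding_seq.compactSpace

theorem continuous_shift : Continuous (shift : MarkovShift A → MarkovShift A) := by
  let : TopologicalSpace S := ⊥
  have : DiscreteTopology S := ⟨rfl⟩
  refine isInducing_seq.continuous_iff.2 (continuous_pi fun i => ?_)
  exact (continuous_apply (i + 1)).comp isInducing_seq.continuous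

theorem continuous_comp_seq_apply {Y : Type*} [TopologicalSpace Y] (e : S → Y) (i : ℕ) :
    Continuous fun ω : MarkovShift A => e (ω.seq i) := by
  let : TopologicalSpace S := ⊥
  have : DiscreteTopology S := ⟨rfl⟩
  exact continuous_of_discreteTopology.comp
    ((continuous_apply i).comp isInducing_seq.continuous)

theorem seq_shift_iterate (ω : MarkovShift A) (k i : ℕ) :
    (shift^[k] ω).seq i = ω.seq (i + k) := by
  induction k generalizing ω with
  | zero => rfl
  | succ k ih =>
    rw [Function.iterate_succ_apply, ih]
    simp only [shift, add_assoc]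

/-- The first n letters of the glued point are the word itself, and the itinerary for the
first-letter partition records them. -/
theorem injective_itinerary_glue {k n : ℕ} (e : S ≃ Fin k) (ωa : MarkovShift A) :
    Function.Injective fun w : WordTo A n (ωa.seq 0) =>
      itinerary shift (fun ω : MarkovShift A => e (ω.seq 0)) n (ωa.glue w) := by
  intro w w' hww
  apply Subtype.ext
  funext j
  have := congrFun hww j
  simp only [itinerary, seq_shift_iterate, zero_add, EmbeddingLike.apply_eq_iff_eq] at this
  simpa [glue] using this

end MarkovShift

/-- The Hölder modulus in the first variable is uniform in the second, so separate continuity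
upgrades to joint continuity. -/
theorem continuous_uncurry_of_holderWith {Y Z E : Type*} [PseudoMetricSpace Y]
    [TopologicalSpace Z] [PseudoMetricSpace E] {f : Y → Z → E} {C β : ℝ≥0} (hβ : 0 < β)
    (hf : ∀ z, HolderWith C β fun y => f y z) (hc : ∀ y, Continuous (f y)) :
    Continuous fun x : Y × Z => f x.1 x.2 := by
  refine continuous_iff_continuousAt.2 fun ⟨y₀, z₀⟩ => ?_
  rw [ContinuousAt, tendsto_iff_dist_tendsto_zero]
  have h1 : Tendsto (fun x : Y × Z => (C : ℝ) * dist x.1 y₀ ^ (β : ℝ)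
      + dist (f y₀ x.2) (f y₀ z₀)) (𝓝 (y₀, z₀)) (𝓝 0) := by
    have hcont : Continuous fun x : Y × Z => (C : ℝ) * dist x.1 y₀ ^ (β : ℝ)
        + dist (f y₀ x.2) (f y₀ z₀) := by
      refine Continuous.add (continuous_const.mul (Continuous.rpow_const (by fun_prop)
        fun _ => Or.inr β.coe_nonneg)) (((hc y₀).comp continuous_snd).dist continuous_const)
    have := hcont.tendsto (y₀, z₀)
    simpa [Real.zero_rpow (NNReal.coe_pos.2 hβ).ne'] using this
  refine squeeze_zero (fun _ => dist_nonneg) (fun x => ?_) h1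
  exact (dist_triangle _ (f y₀ x.2) _).trans (add_le_add ((hf x.2).dist_le x.1 y₀) le_rfl)

/-! ### Maximal Birkhoff sums of the skew product. -/

section SkewProduct

variable {S : Type*} {A : S → S → Prop} {X : Type*}

theorem skewProduct_iterate (F : MarkovShift A → X → X) (k : ℕ) (ω : MarkovShift A) (t : X) :
    (skewProduct F)^[k] (ω, t) = (MarkovShift.shift^[k] ω, fiberIter F k ω t) := by
  induction k with
  | zero => rfl
  | succ k ih =>
    rw [Function.iterate_succ_apply', ih, Function.iterate_succ_apply']
    rfl

/-- `sup_t ∑_{k<n} φ̂(F̂^k(ω, t))`. -/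
noncomputable def maxBirkhoffSum (F : MarkovShift A → X → X) (φ : X → MarkovShift A → ℝ) (n : ℕ)
    (ω : MarkovShift A) : ℝ :=
  ⨆ t : X, ∑ k ∈ Finset.range n, jointPotential φ ((skewProduct F)^[k] (ω, t))

theorem maxInstability_eq (F : MarkovShift A → X → X) (φ : X → MarkovShift A → ℝ) :
    maxInstability F φ = fun ω => limsup (fun n : ℕ => maxBirkhoffSum F φ n ω / n) atTop := by
  funext ω
  rw [maxInstability]
  congr 1
  funext n
  rw [maxBirkhoffSum, ← Real.mul_iSup_of_nonneg (by positivity)]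
  ring

theorem abs_birkhoffSum_le {F : MarkovShift A → X → X} {φ : X → MarkovShift A → ℝ} {C : ℝ}
    (hφ : ∀ t ω, |φ t ω| ≤ C) (n : ℕ) (x : MarkovShift A × X) :
    |∑ k ∈ Finset.range n, jointPotential φ ((skewProduct F)^[k] x)| ≤ C * n := by
  refine (Finset.abs_sum_le_sum_abs _ _).trans ?_
  refine (Finset.sum_le_sum fun k _ => hφ _ _).trans ?_
  simp [mul_comm]

theorem birkhoffSum_le_maxBirkhoffSum {F : MarkovShift A → X → X} {φ : X → MarkovShift A → ℝ}
    {C : ℝ} (hφ : ∀ t ω, |φ t ω| ≤ C) (n : ℕ) (x : MarkovShift A × X) :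
    ∑ k ∈ Finset.range n, jointPotential φ ((skewProduct F)^[k] x) ≤ maxBirkhoffSum F φ n x.1 :=
  le_ciSup (f := fun t => ∑ k ∈ Finset.range n, jointPotential φ ((skewProduct F)^[k] (x.1, t)))
    ⟨C * n, by
      rintro _ ⟨t, rfl⟩
      exact (abs_le.1 (abs_birkhoffSum_le hφ n _)).2⟩ x.2

theorem isSubadditiveCocycle_maxBirkhoffSum [TopologicalSpace X] [CompactSpace X] [Nonempty X]
    {F : MarkovShift A → X → X} {φ : X → MarkovShift A → ℝ} {C : ℝ}
    (hF : Continuous fun x : MarkovShift A × X => F x.1 x.2)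
    (hφc : Continuous fun x : MarkovShift A × X => φ x.2 x.1) (hφ : ∀ t ω, |φ t ω| ≤ C) :
    IsSubadditiveCocycle MarkovShift.shift (maxBirkhoffSum F φ) C where
  continuous n := by
    have hsk : Continuous (skewProduct F) :=
      (MarkovShift.continuous_shift.comp continuous_fst).prodMk hF
    have hS : Continuous fun x : MarkovShift A × X =>
        ∑ k ∈ Finset.range n, jointPotential φ ((skewProduct F)^[k] x) :=
      continuous_finsetSum _ fun k _ => hφc.comp (hsk.iterate k)
    -- A supremum over the compact X of a jointly continuous function is continuous in ω.
    have := isCompact_univ.continuous_sSup (K := (Set.univ : Set X)) (f := fun ω t =>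
      ∑ k ∈ Finset.range n, jointPotential φ ((skewProduct F)^[k] (ω, t))) hS
    simpa only [Set.image_univ] using! this
  add_le m n ω := by
    refine ciSup_le fun t => ?_
    rw [Finset.sum_range_add]
    refine add_le_add (birkhoffSum_le_maxBirkhoffSum hφ m (ω, t)) ?_
    have := birkhoffSum_le_maxBirkhoffSum (F := F) hφ n ((skewProduct F)^[m] (ω, t))
    rw [skewProduct_iterate] at this
    refine le_trans (le_of_eq ?_) this
    refine Finset.sum_congr rfl fun k _ => ?_
    rw [← skewProduct_iterate, ← Function.iterate_add_apply, add_comm]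
  bound n ω := by
    obtain ⟨t⟩ := ‹Nonempty X›
    refine abs_le.2 ⟨?_, ciSup_le fun t => (abs_le.1 (abs_birkhoffSum_le hφ n _)).2⟩
    exact (abs_le.1 (abs_birkhoffSum_le hφ n (ω, t))).1.trans
      (birkhoffSum_le_maxBirkhoffSum hφ n (ω, t))

/-- Each word is allowed its own optimal t, so the bound no longer depends on t. -/
theorem partitionSum_le [Finite S] {F : MarkovShift A → X → X} {φ : X → MarkovShift A → ℝ} {C : ℝ}
    (hφ : ∀ t ω, |φ t ω| ≤ C) (ωa : MarkovShift A) (n : ℕ) (t : X) :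
    partitionSum F φ ωa n t ≤
      ∑ w : MarkovShift.WordTo A n (ωa.seq 0), Real.exp (maxBirkhoffSum F φ n (ωa.glue w)) := by
  refine Finset.sum_le_sum fun w _ => Real.exp_le_exp.2 ?_
  have := birkhoffSum_le_maxBirkhoffSum (F := F) hφ n (ωa.glue w, t)
  simpa only [skewProduct_iterate, jointPotential] using this

/-- Whenever the pressure exceeds `c`, there are infinitely many `n` for which some word ends in
the base letter and the partition sums of the maximal Birkhoff sums exceed `e^{cn}`. -/
theorem frequently_lt_log_sum_of_lt_pressure [Finite S] {F : MarkovShift A → X → X}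
    {φ : X → MarkovShift A → ℝ} {C : ℝ} (hφ : ∀ t ω, |φ t ω| ≤ C) {ωa : MarkovShift A} {c : ℝ}
    (hc : (c : EReal) < pressure F φ ωa) :
    ∃ᶠ n : ℕ in atTop, Nonempty (MarkovShift.WordTo A n (ωa.seq 0)) ∧
      c * n ≤ Real.log (∑ w : MarkovShift.WordTo A n (ωa.seq 0),
        Real.exp (maxBirkhoffSum F φ n (ωa.glue w))) := by
  refine ((frequently_lt_of_lt_limsup (by isBoundedDefault) hc).and_eventually
    (eventually_gt_atTop 0)).mono fun n hn => ?_
  obtain ⟨hlt, hn0⟩ := hn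
  have hn' : (0 : ℝ) < n := by exact_mod_cast hn0
  set Z := ∑ w : MarkovShift.WordTo A n (ωa.seq 0),
    Real.exp (maxBirkhoffSum F φ n (ωa.glue w)) with hZ
  have hle : ENNReal.log (⨆ t : X, ENNReal.ofReal (partitionSum F φ ωa n t)) ≤
      ENNReal.log (ENNReal.ofReal Z) :=
    ENNReal.log_monotone (iSup_le fun t => ENNReal.ofReal_le_ofReal (partitionSum_le hφ ωa n t))
  have hlt' : (c : EReal) < ENNReal.log (ENNReal.ofReal Z) / (n : EReal) :=
    hlt.trans_le (EReal.div_le_div_right_of_nonneg (by positivity) hle)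
  -- Without words the sum is 0 and its logarithm is -∞, which cannot exceed c.
  rcases isEmpty_or_nonempty (MarkovShift.WordTo A n (ωa.seq 0)) with hE | hN
  · have hZ0 : Z = 0 := by rw [hZ]; exact Finset.sum_of_isEmpty _
    rw [hZ0, ENNReal.ofReal_zero, ENNReal.log_zero,
      EReal.bot_div_of_pos_ne_top (by exact_mod_cast hn0) (EReal.natCast_ne_top n)] at hlt'
    exact absurd hlt' not_lt_bot
  · refine ⟨hN, ?_⟩
    have hZ0 : 0 < Z := Finset.sum_pos (fun _ _ => Real.exp_pos _) Finset.univ_nonempty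
    rw [ENNReal.log_ofReal_of_pos hZ0] at hlt'
    have : (c : EReal) < ((Real.log Z / n : ℝ) : EReal) := by
      rwa [EReal.coe_div]
    exact ((lt_div_iff₀ hn').1 (EReal.coe_lt_coe_iff.1 this)).le

end SkewProduct

end POE

/-! ### The pressure bound. -/

theorem mainTheorem6 {S : Type*} [Finite S] (A : S → S → Prop)
    {X : Type*} [MetricSpace X] [CompactSpace X] [Nonempty X]
    (F : POE.MarkovShift A → X ≃ₜ X)
    (hF : ∃ α : ℝ≥0, 0 < α ∧ ∀ ω, ∃ C : ℝ≥0, HolderWith C α (F ω))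
    (hFω : ∃ C β : ℝ≥0, 0 < β ∧ ∀ t, HolderWith C β (fun ω => F ω t))
    (φ : X → POE.MarkovShift A → ℝ)
    (hφ : ∃ C β : ℝ≥0, 0 < β ∧ ∀ t, HolderWith C β (φ t) ∧ ∀ ω, |φ t ω| ≤ C)
    (hφt : ∀ ω, Continuous fun t => φ t ω)
    (ωa : POE.MarkovShift A) :
    (∀ ν : Measure (POE.MarkovShift A), IsProbabilityMeasure ν →
        Ergodic POE.MarkovShift.shift ν →
        Integrable (POE.maxInstability (fun ω => F ω) φ) ν) ∧
    POE.pressure (fun ω => F ω) φ ωa ≤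
      ⨆ (ν : Measure (POE.MarkovShift A)) (_ : IsProbabilityMeasure ν)
        (_ : Ergodic POE.MarkovShift.shift ν),
        POE.ksEntropy POE.MarkovShift.shift ν +
          ((∫ ω, POE.maxInstability (fun ω => F ω) φ ω ∂ν : ℝ) : EReal) := by
  obtain ⟨CF, βF, hβF, hFω⟩ := hFω
  obtain ⟨C, β, hβ, hφ⟩ := hφ
  have hFc : Continuous fun x : POE.MarkovShift A × X => F x.1 x.2 :=
    POE.continuous_uncurry_of_holderWith (f := fun ω t => F ω t) hβF hFω
      fun ω => (F ω).continuous
  have hφc : Continuous fun x : POE.MarkovShift A × X => φ x.2 x.1 :=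
    POE.continuous_uncurry_of_holderWith (f := fun ω t => φ t ω) hβ (fun t => (hφ t).1) hφt
  have hφb : ∀ t ω, |φ t ω| ≤ C := fun t => (hφ t).2
  have hΦ := POE.isSubadditiveCocycle_maxBirkhoffSum (F := fun ω => F ω) hFc hφc hφb
  obtain ⟨k, ⟨e⟩⟩ := Finite.exists_equiv_fin S
  have hT := POE.MarkovShift.continuous_shift (A := A)
  -- The partition by first letter, whose n-itineraries are the words of length n.
  have hp : Continuous fun ω : POE.MarkovShift A => e (ω.seq 0) :=
    POE.MarkovShift.continuous_comp_seq_apply e 0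
  rw [POE.maxInstability_eq]
  refine ⟨fun ν hν _ => hΦ.integrable_limsup ν, ?_⟩
  -- It suffices to bound every real c strictly below the pressure, which also covers infinite
  -- values.
  refine EReal.ge_of_forall_gt_iff_ge.1 fun c hc => ?_
  obtain ⟨ν₀, hν₀, hle₀⟩ := hΦ.exists_measurePreserving_forall_le hT hp (c := c)
    ((POE.frequently_lt_log_sum_of_lt_pressure hφb hc).mono fun n ⟨_, hn⟩ => by
      obtain ⟨σ, hσ, hfe⟩ := POE.exists_freeEnergy_eq_log_sum_exp
        (Φ := POE.maxBirkhoffSum (fun ω => F ω) φ) hT hp (fun w => ωa.glue w)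
        (POE.MarkovShift.injective_itinerary_glue (n := n) e ωa)
      exact ⟨σ, hσ, hfe ▸ hn⟩)
  obtain ⟨ν, hν, herg, hle⟩ := hΦ.exists_ergodic_forall_le hT hp hν₀ hle₀
  exact le_iSup_of_le ν (le_iSup_of_le hν (le_iSup_of_le herg
    (hΦ.le_ksEntropy_add_integral_limsup hT hp herg.toMeasurePreserving hle)))
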